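/- Corollary 3.31. Let $A$ be a $*$-ring (not necessarily unital). For $B\subseteq A$ put $|B|^2=\{b^*b: b\in B\}$, let $B_\Sigma$ be the additive subsemigroup of $A$ generated by $|B|^2$, and let $B/\mathbb N=\{a\in A: na\in B \text{ for some } n\in\mathbb N\}$, where $\mathbb N=\{1,2,\dots\}$. For $a\in A$ define, in $[0,\infty]$ with $\inf\emptyset=\infty$, $$\lceil a\rceil=\sup_{b\in A}\inf\{m/n: m,n\in\mathbb N,\ mbb^*-nbab^*\in A_\Sigma\},\qquad \|a\|=\sqrt{\lceil aa^*\rceil\vee\lceil a^*a\rceil}.$$ Write $A^1=\{a\in A:\|a\|\le 1\}$, $a\le b$ if $\lceil a-b\rceil=0$, and $B_+=\{a\in B: 0\le a\}$. Assume that, for all $a\in A$: $\lceil -a\rceil=0$ implies $\lceil a\rceil<\infty$ (Archimedean); $\lceil a\rceil=\lceil -a\rceil=0$ implies $a=0$ (infinitesimal-free); and $aa^*=0$ implies $a=0$ (proper). Let $(S,E)$ be a Weyl $*$-semigroup with $S\subseteq A^1$; that is, $S\subseteq A^1$ and $E\subseteq S$ are closed under the product and the involution of $A$, $a^*Ea\subseteq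 E$ for all $a\in S$, and $|S|^2\subseteq E$ with every element of $|S|^2$ commuting with every element of $E$. Let $L$ be a commutative $*$-subring of $A$ (not necessarily unital) which is a lattice with respect to $\le$ and is $S$-hereditary, i.e. $|S|^2\subseteq L$, and every $a\in L_+$ with $a\le p$ for some $p\in|S|^2$ lies in $S$. Assume moreover that $$L_+=L_\Sigma/\mathbb N\qquad\text{or}\qquad A \text{ is unital and every self-adjoint product of two elements of } A_+ \text{ lies in } A_+.$$ For $a,b\in S$ write $a\lesssim b$ if $ba^*\in E$ and $a=ab^*b$. A filter is a non-empty $U\subseteq S$ such that, for all $a,b\in S$, one has $a,b\in U$ if and only if there is $c\in U$ with $c\lesssim a$ and $c\lesssim b$; an ultrafilter is a maximal element among the filters different from $S$. Let $\mathcal U(S)$, the Weyl groupoid, be the set of all ultrafilters, with the topology generated by the sets $\mathcal U_a=\{U\in\mathcal U(S): a\in U\}$ for $a\in S$. Then $\mathcal U(S)$ is locally compact, i.e. every point has a neighbourhood base consisting of compact (not necessarily Hausdorff) sets. -/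

import Mathlib

open scoped ENNReal

namespace WeylStar

/-! ### `*`-semigroups -/

section Semigroup

variable {A : Type*} [Semigroup A] [StarMul A]

/-- The `*`-squares `|T|² = {a⋆ a : a ∈ T}` of a subset `T`. -/
def starSquares (T : Set A) : Set A := {x | ∃ a ∈ T, x = star a * a}

/-- `T` is a `*`-subsemigroup: `T T ⊆ T = T⋆`. -/
structure IsStarSubsemigroup (T : Set A) : Prop where
  mul_mem : ∀ a ∈ T, ∀ b ∈ T, a * b ∈ T
  star_mem : ∀ a ∈ T, star a ∈ T

/-- `(S, E)` is a Weyl `*`-semigroup, where `S` is a `*`-subsemigroup of an ambient `*`-semigroup: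
`E` is a `*`-subsemigroup of `S`, it is `*`-normal in `S`, and its centre contains the `*`-squares
of `S`, i.e. `|S|² ⊆ E ∩ E'`. -/
structure IsWeylStarSemigroup (S E : Set A) : Prop where
  isStarSubsemigroup : IsStarSubsemigroup S
  isStarSubsemigroup_sub : IsStarSubsemigroup E
  sub_subset : E ⊆ S
  star_normal : ∀ a ∈ S, ∀ e ∈ E, star a * e * a ∈ E
  central_starSquares : starSquares S ⊆ E ∩ Set.centralizer E

/-- Domination `a ≺ b`. -/
def Dom (a b : A) : Prop := a = a * b

/-- Compatibility `a ∼ b` with respect to `E`. -/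
def Compat (E : Set A) (a b : A) : Prop := a * star b ∈ E

/-- `*`-domination `a ≾ b`, i.e. `b ∼ a ≺ b⋆ b`. -/
def StarDom (E : Set A) (a b : A) : Prop := Compat E b a ∧ Dom a (star b * b)

/-- `U` is a filter in `S`: a non-empty subset such that, for `a b ∈ S`, both lie in `U` if and
only if they have a common lower `≾`-bound in `U`. -/
structure IsStarFilter (S E U : Set A) : Prop where
  subset : U ⊆ S
  nonempty : U.Nonempty
  mem_iff : ∀ a ∈ S, ∀ b ∈ S,
    (a ∈ U ∧ b ∈ U) ↔ ∃ c ∈ U, StarDom E c a ∧ StarDom E c b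

/-- An ultrafilter is a maximal proper filter (proper means different from `S`). -/
structure IsStarUltrafilter (S E U : Set A) : Prop where
  isStarFilter : IsStarFilter S E U
  ne : U ≠ S
  maximal : ∀ V : Set A, IsStarFilter S E V → V ≠ S → U ⊆ V → V = U

/-- The (underlying set of the) Weyl groupoid `𝒰(S)`: the ultrafilters of `(S, E)`. -/
def WeylGroupoid (S E : Set A) : Type _ := {U : Set A // IsStarUltrafilter S E U}

/-- The set `𝒰_a` of ultrafilters containing `a`. -/
def WeylGroupoid.basicOpen (S E : Set A) (a : A) : Set (WeylGroupoid S E) := {U | a ∈ U.1}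

/-- The canonical topology, generated by the sets `𝒰_a` for `a ∈ S`. -/
instance WeylGroupoid.instTopologicalSpace (S E : Set A) :
    TopologicalSpace (WeylGroupoid S E) :=
  TopologicalSpace.generateFrom {O | ∃ a ∈ S, O = WeylGroupoid.basicOpen S E a}

end Semigroup

/-! ### `*`-rings (not necessarily unital) -/

section Ring

variable {A : Type*} [NonUnitalRing A] [StarRing A]

/-- `B_Σ`, the additive subsemigroup generated by the `*`-squares of `B`. -/
def sumSquares (B : Set A) : Set A := (AddSubsemigroup.closure (starSquares B) : Set A)

/-- `B / ℕ`, the elements of `A` with some positive multiple in `B`. -/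
def fractions (B : Set A) : Set A := {a | ∃ n : ℕ, 0 < n ∧ n • a ∈ B}

/-- The asymmetric seminorm
`⌈a⌉ = sup_b inf {m / n : m b b⋆ - n b a b⋆ ∈ A_Σ} ∈ [0, ∞]`, where `inf ∅ = ∞`. -/
noncomputable def upperNorm (a : A) : ℝ≥0∞ :=
  ⨆ b : A, ⨅ (m : ℕ) (n : ℕ)
    (_ : 0 < m ∧ 0 < n ∧
      m • (b * star b) - n • (b * a * star b) ∈ sumSquares (Set.univ : Set A)),
    (m : ℝ≥0∞) / (n : ℝ≥0∞)

/-- `‖a‖ = √(⌈a a⋆⌉ ∨ ⌈a⋆ a⌉) ∈ [0, ∞]`. -/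
noncomputable def starNorm (a : A) : ℝ≥0∞ :=
  (upperNorm (a * star a) ⊔ upperNorm (star a * a)) ^ (1 / 2 : ℝ)

variable (A) in
/-- The unit ball `A¹`. -/
def unitBall : Set A := {a | starNorm a ≤ 1}

/-- The relation `a ≤ b`, i.e. `⌈a - b⌉ = 0`. -/
def StarLE (a b : A) : Prop := upperNorm (a - b) = 0

/-- The positive elements `B₊` of a subset `B`. -/
def positives (B : Set A) : Set A := {a | a ∈ B ∧ StarLE 0 a}

variable (A) in
/-- `A` is Archimedean. -/
def IsArchimedeanStarRing : Prop := ∀ a : A, upperNorm (-a) = 0 → upperNorm a < ⊤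

variable (A) in
/-- `A` is infinitesimal-free. -/
def IsInfinitesimalFree : Prop := ∀ a : A, upperNorm a = 0 → upperNorm (-a) = 0 → a = 0

variable (A) in
/-- `A` is proper. -/
def IsProperStarRing : Prop := ∀ a : A, a * star a = 0 → a = 0

variable (A) in
/-- `A` has a multiplicative unit. -/
def IsUnital : Prop := ∃ u : A, ∀ a : A, u * a = a ∧ a * u = a

variable (A) in
/-- `(A₊ A₊)_sa ⊆ A₊`: a self-adjoint product of two positive elements is positive. -/
def PositiveProducts : Prop :=
  ∀ p ∈ positives (Set.univ : Set A), ∀ q ∈ positives (Set.univ : Set A),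
    star (p * q) = p * q → p * q ∈ positives (Set.univ : Set A)

/-- `L` is a commutative `*`-subring. -/
structure IsCommStarSubring (L : NonUnitalSubring A) : Prop where
  star_mem : ∀ a ∈ L, star a ∈ L
  mul_comm : ∀ a ∈ L, ∀ b ∈ L, a * b = b * a

/-- `L` is `S`-hereditary: it contains `|S|²`, and every positive element of `L` below an element
of `|S|²` lies in `S`. -/
structure IsHereditary (S L : Set A) : Prop where
  starSquares_subset : starSquares S ⊆ L
  mem_of_le : ∀ a ∈ positives L, ∀ p ∈ starSquares S, StarLE a p → a ∈ S

/-- `L` with the restriction of `≤` has all binary suprema and infima (formed within `L`). -/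
structure IsLatticeOn (L : Set A) : Prop where
  exists_sup : ∀ a ∈ L, ∀ b ∈ L, ∃ c ∈ L,
    StarLE a c ∧ StarLE b c ∧ ∀ d ∈ L, StarLE a d → StarLE b d → StarLE c d
  exists_inf : ∀ a ∈ L, ∀ b ∈ L, ∃ c ∈ L,
    StarLE c a ∧ StarLE c b ∧ ∀ d ∈ L, StarLE d a → StarLE d b → StarLE d c

end Ring

end WeylStar

/-! The ring `L` becomes a commutative lattice-ordered ring in which multiplication by a positive
element is positive and bounded, and in which the `*`-squares of `S` are contractions
(`exists_isDiagonal`). The rest needs only this structure and the Weyl `*`-semigroup axioms. Its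
elements may be pictured as functions: with `r = a⋆ a`, the equation `y * r = y` says that `y` lives
where `r` is 1. An ultrafilter containing `a` is studied through its trace, the `*`-squares `y` with
`y * r = y` for which `a y` belongs to it.

Points are produced by `exists_ultrafilter`. Its input is a sum-closed set `T` of elements `u ≥ 0`,
thought of as vanishing at the desired point, none of which dominates `r`; the ultrafilter obtained
contains `a x` for admissible `x` acting as the identity on some `(r - u)⁺`. Applied to the elements
killed by some `v * d`, this gives the separation lemma `exists_memTrace_mul_eq_zero`.

For `b ≾ a` in an ultrafilter and `q = b⋆ b`, the compact neighbourhood is `region`, morally the set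
where `q` equals `r`. If a cover of it had no finite subcover, let `T` consist of those `u` that,
off finitely many members of the cover, are locally dominated by multiples of `r - q`. The resulting
ultrafilter `W` lies in the region, hence in some member of the cover. Separation then puts into `T`
an element `d` that is the identity near `W`, although elements of `T` should vanish there
(`isCompact_region`). -/

namespace WeylStar

/-! ### Almost-bounds and the positive cone of a `*`-ring. -/

section PositiveCone

variable {A : Type*} [NonUnitalRing A] [StarRing A]

variable (A) in
/-- The cone of elements with some positive multiple a sum of `*`-squares. -/
def sumCone : AddSubmonoid A where
  carrier := fractions (sumSquares (Set.univ : Set A))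
  zero_mem' := ⟨1, one_pos, AddSubsemigroup.subset_closure ⟨0, trivial, by simp⟩⟩
  add_mem' := by
    rintro a b ⟨m, hm, ha⟩ ⟨n, hn, hb⟩
    have key : ∀ (k : ℕ), 0 < k → ∀ x ∈ sumSquares (Set.univ : Set A),
        k • x ∈ sumSquares (Set.univ : Set A) := by
      intro k hk x hx
      induction k, hk using Nat.le_induction with
      | base => simpa using hx
      | succ k hk ih => rw [succ_nsmul]; exact AddSubsemigroup.add_mem _ ih hx
    refine ⟨m * n, Nat.mul_pos hm hn, ?_⟩
    rw [nsmul_add, mul_comm, mul_nsmul', mul_comm n m, mul_nsmul' b m n]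
    exact AddSubsemigroup.add_mem _ (key n hn _ ha) (key m hm _ hb)

theorem sumSquares_subset_sumCone {x : A} (hx : x ∈ sumSquares (Set.univ : Set A)) :
    x ∈ sumCone A := ⟨1, one_pos, by simpa using hx⟩

theorem mul_star_self_mem_sumCone (b : A) : b * star b ∈ sumCone A :=
  sumSquares_subset_sumCone (AddSubsemigroup.subset_closure ⟨star b, trivial, by simp⟩)

theorem mem_sumCone_of_nsmul_mem {n : ℕ} (hn : 0 < n) {x : A} (hx : n • x ∈ sumCone A) :
    x ∈ sumCone A := by
  obtain ⟨m, hm, h⟩ := hx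
  exact ⟨m * n, Nat.mul_pos hm hn, by rwa [mul_nsmul']⟩

theorem conj_mem_sumCone {x : A} (hx : x ∈ sumCone A) (c : A) :
    c * x * star c ∈ sumCone A := by
  obtain ⟨n, hn, h⟩ := hx
  refine mem_sumCone_of_nsmul_mem hn ?_
  rw [← smul_mul_assoc, ← mul_smul_comm]
  apply sumSquares_subset_sumCone
  generalize n • x = y at h
  induction h using AddSubsemigroup.closure_induction with
  | mem y hy =>
    obtain ⟨a, -, rfl⟩ := hy
    exact AddSubsemigroup.subset_closure ⟨a * star c, trivial, by simp [mul_assoc]⟩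
  | add y z _ _ hy hz =>
    rw [mul_add, add_mul]
    exact AddSubsemigroup.add_mem _ hy hz

theorem isSelfAdjoint_of_mem_sumSquares {x : A} (h : x ∈ sumSquares (Set.univ : Set A)) :
    star x = x := by
  induction h using AddSubsemigroup.closure_induction with
  | mem y hy =>
    obtain ⟨a, -, rfl⟩ := hy
    simp
  | add y z _ _ hy hz => rw [star_add, hy, hz]

/-- `a` is bounded above by `M` up to arbitrarily small errors. -/
def AlmostLE (a : A) (M : ℤ) : Prop :=
  ∀ (b : A) (k : ℕ), b * star b + k • (M • (b * star b) - b * a * star b) ∈ sumCone A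

theorem almostLE_of_upperNorm_le {a : A} {M : ℕ} (h : upperNorm a ≤ M) : AlmostLE a M := by
  intro b k
  have hb : (⨅ (m : ℕ) (n : ℕ) (_ : 0 < m ∧ 0 < n ∧
      m • (b * star b) - n • (b * a * star b) ∈ sumSquares (Set.univ : Set A)),
      (m : ℝ≥0∞) / (n : ℝ≥0∞)) < (M : ℝ≥0∞) + ((k + 1 : ℕ) : ℝ≥0∞)⁻¹ := by
    refine lt_of_le_of_lt ((le_iSup (fun b : A => ⨅ (m : ℕ) (n : ℕ) (_ : 0 < m ∧ 0 < n ∧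
      m • (b * star b) - n • (b * a * star b) ∈ sumSquares (Set.univ : Set A)),
      (m : ℝ≥0∞) / (n : ℝ≥0∞)) b).trans h) ?_
    exact ENNReal.lt_add_right (ENNReal.natCast_ne_top M) (by simp)
  simp only [iInf_lt_iff] at hb
  obtain ⟨m, n, ⟨hm, hn, hmem⟩, hlt⟩ := hb
  have hle : (k + 1) * m ≤ ((k + 1) * M + 1) * n := by
    have hn' : (n : ℝ≥0∞) ≠ 0 := by exact_mod_cast hn.ne'
    have h1 := (ENNReal.div_le_iff hn' (ENNReal.natCast_ne_top n)).1 hlt.le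
    have h2 := mul_le_mul_right h1 ((k + 1 : ℕ) : ℝ≥0∞)
    have h3 : ((k + 1 : ℕ) : ℝ≥0∞) * (((M : ℝ≥0∞) + ((k + 1 : ℕ) : ℝ≥0∞)⁻¹) * n)
        = (((k + 1) * M + 1) * n : ℕ) := by
      rw [← mul_assoc, mul_add, ENNReal.mul_inv_cancel (by simp) (ENNReal.natCast_ne_top _)]
      push_cast; ring
    rw [h3] at h2
    exact_mod_cast h2
  refine mem_sumCone_of_nsmul_mem (Nat.mul_pos hn (Nat.succ_pos k)) ?_
  -- `j` counts the copies of `b b⋆` left over after clearing denominators; it is nonnegative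
  -- because `m / n ≤ M + 1 / (k + 1)`.
  obtain ⟨j, hj⟩ : ∃ j : ℕ, ((n * (k + 1) : ℕ) : ℤ) * (1 + k * M) = (k * (k + 1) * m : ℕ) + j := by
    have : (k * (k + 1) * m : ℕ) ≤ n * (k + 1) * (1 + k * M) := by
      have h4 : k * ((k + 1) * m) ≤ k * (((k + 1) * M + 1) * n) := Nat.mul_le_mul_left _ hle
      nlinarith [Nat.zero_le n]
    obtain ⟨j, hj⟩ := Nat.exists_eq_add_of_le this
    exact ⟨j, by exact_mod_cast hj⟩
  have e : (n * (k + 1)) • (b * star b + k • ((M : ℤ) • (b * star b) - b * a * star b))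
      = (k * (k + 1)) • (m • (b * star b) - n • (b * a * star b)) + j • (b * star b) := by
    have h5 := congrArg (fun z : ℤ => z • (b * star b)) hj
    simp only [Nat.cast_mul, add_smul] at h5
    simp only [← natCast_zsmul, smul_add, smul_sub, smul_smul] at h5 ⊢
    push_cast at h5 ⊢
    rw [← sub_eq_zero] at h5 ⊢
    rw [← h5]
    module
  rw [e]
  exact add_mem (nsmul_mem (sumSquares_subset_sumCone hmem) _)
    (nsmul_mem (mul_star_self_mem_sumCone b) _)

theorem upperNorm_eq_zero_of_almostLE {a : A} (h : AlmostLE a 0) : upperNorm a = 0 := by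
  rw [upperNorm, ENNReal.iSup_eq_zero]
  intro b
  refine le_antisymm (ENNReal.le_of_forall_pos_le_add ?_) zero_le
  intro ε hε _
  obtain ⟨k, hk⟩ := ENNReal.exists_inv_nat_lt (a := (ε : ℝ≥0∞)) (by exact_mod_cast hε.ne')
  have hk0 : 0 < k := by
    rcases Nat.eq_zero_or_pos k with rfl | h0
    · simp at hk
    · exact h0
  obtain ⟨n, hn, hmem⟩ := h b k
  rw [zero_add]
  refine le_trans ?_ hk.le
  refine iInf_le_of_le n (iInf_le_of_le (n * k) (iInf_le_of_le ⟨hn, Nat.mul_pos hn hk0, ?_⟩ ?_))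
  · convert hmem using 1
    rw [zero_smul, zero_sub, mul_smul]
    simp [smul_add, sub_eq_add_neg]
  · have hn' : (n : ℝ≥0∞) ≠ 0 := by exact_mod_cast hn.ne'
    rw [Nat.cast_mul, ENNReal.div_eq_inv_mul, ENNReal.mul_inv (by simp) (by simp), mul_right_comm,
      ENNReal.inv_mul_cancel hn' (ENNReal.natCast_ne_top _), one_mul]

/-- Positivity `0 ≤ a`. -/
def Pos (a : A) : Prop := upperNorm (-a) = 0

theorem starLE_iff {a b : A} : StarLE a b ↔ Pos (b - a) := by
  rw [StarLE, Pos, neg_sub]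

theorem mem_positives_iff {B : Set A} {a : A} : a ∈ positives B ↔ a ∈ B ∧ Pos a := by
  rw [positives, Set.mem_ofPred_eq, starLE_iff, sub_zero]

theorem pos_iff {a : A} : Pos a ↔ ∀ (b : A) (k : ℕ), b * star b + k • (b * a * star b) ∈ sumCone A := by
  have e : AlmostLE (-a) 0 ↔
      ∀ (b : A) (k : ℕ), b * star b + k • (b * a * star b) ∈ sumCone A := by
    simp [AlmostLE]
  rw [← e]
  exact ⟨fun h => almostLE_of_upperNorm_le (M := 0) (by simpa using le_of_eq h),
    upperNorm_eq_zero_of_almostLE⟩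

theorem pos_of_mem_sumCone {a : A} (h : a ∈ sumCone A) : Pos a :=
  pos_iff.2 fun b _ => add_mem (mul_star_self_mem_sumCone b) (nsmul_mem (conj_mem_sumCone h b) _)

theorem Pos.add {a b : A} (ha : Pos a) (hb : Pos b) : Pos (a + b) := by
  rw [pos_iff] at *
  intro c k
  refine mem_sumCone_of_nsmul_mem two_pos ?_
  convert add_mem (ha c (2 * k)) (hb c (2 * k)) using 1
  rw [mul_add, add_mul]
  module

theorem Pos.of_nsmul {a : A} {n : ℕ} (hn : 0 < n) (h : Pos (n • a)) : Pos a := by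
  rw [pos_iff] at *
  intro c k
  refine mem_sumCone_of_nsmul_mem hn ?_
  obtain ⟨j, rfl⟩ := Nat.exists_eq_add_of_le' hn
  convert add_mem (h c k) (nsmul_mem (mul_star_self_mem_sumCone c) j) using 1
  rw [mul_smul_comm, smul_mul_assoc]
  module

/-- Sums of `*`-squares are self-adjoint, so every `b (a - a⋆) b⋆` is torsion. Torsion elements are
infinitesimal, hence zero, and this in turn makes `a - a⋆` itself infinitesimal. -/
theorem Pos.star_eq (hInf : IsInfinitesimalFree A) {a : A} (h : Pos a) : star a = a := by
  rw [pos_iff] at h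
  have h0 : ∀ b : A, b * (a - star a) * star b = 0 := by
    intro b
    obtain ⟨n, hn, hm⟩ := h b 1
    have h1 := isSelfAdjoint_of_mem_sumSquares hm
    have h2 : n • (b * (a - star a) * star b) = 0 := by
      rw [one_smul] at h1
      simp only [star_nsmul, star_add, star_mul, star_star, ← mul_assoc, smul_add,
        add_right_inj] at h1
      rw [mul_sub, sub_mul, smul_sub, h1, sub_self]
    have h3 : Pos (n • (b * (a - star a) * star b)) := by
      rw [h2]; exact pos_of_mem_sumCone (zero_mem _)
    have h4 : Pos (n • (-(b * (a - star a) * star b))) := by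
      rw [smul_neg, h2, neg_zero]; exact pos_of_mem_sumCone (zero_mem _)
    have h5 := h4.of_nsmul hn
    rw [Pos, neg_neg] at h5
    exact hInf _ h5 (h3.of_nsmul hn)
  have hz : ∀ x : A, (∀ b : A, b * x * star b = 0) → upperNorm x = 0 := fun x hx =>
    upperNorm_eq_zero_of_almostLE fun b k => by simpa [hx b] using mul_star_self_mem_sumCone b
  have := hInf (a - star a) (hz _ h0) (hz _ fun b => by rw [mul_neg, neg_mul, h0, neg_zero])
  exact (sub_eq_zero.1 this).symm

theorem exists_almostLE (hArch : IsArchimedeanStarRing A) {a : A} (h : Pos a) :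
    ∃ N : ℕ, AlmostLE a N := by
  obtain ⟨N, hN⟩ := ENNReal.exists_nat_gt (hArch a h).ne
  exact ⟨N, almostLE_of_upperNorm_le hN.le⟩

/-- Testing the almost-bound against `b * c` leaves an error `b c c⋆ b⋆`; the Archimedean property
bounds `c c⋆` by some `N`, so the error is absorbed by `(N + 1) b b⋆`. -/
theorem AlmostLE.pos_conj (hArch : IsArchimedeanStarRing A) {a : A} {M : ℤ} (h : AlmostLE a M)
    (c : A) : Pos (M • (c * star c) - c * a * star c) := by
  obtain ⟨N, hN⟩ := exists_almostLE hArch (pos_of_mem_sumCone (mul_star_self_mem_sumCone c))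
  rw [pos_iff]
  intro b k
  refine mem_sumCone_of_nsmul_mem (Nat.succ_pos N) ?_
  convert add_mem (hN b 1) (h (b * c) ((N + 1) * k)) using 1
  simp only [star_mul, mul_sub, sub_mul, mul_smul_comm, smul_mul_assoc, mul_assoc]
  simp only [← natCast_zsmul]
  push_cast
  module

/-- The only use of the two alternatives. In one, a multiple of `x` is a sum of squares `d⋆ d` from
`L`, and commutativity reduces to conjugation by `d⋆`. In the other, `M • u - c` is positive for the
unit `u`, and its product with `x` is self-adjoint. -/
theorem mul_pos_of_almostLE (hArch : IsArchimedeanStarRing A) (hInf : IsInfinitesimalFree A)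
    {L : NonUnitalSubring A} (hL : IsCommStarSubring L)
    (hCond : positives (L : Set A) = fractions (sumSquares (L : Set A)) ∨
      (IsUnital A ∧ PositiveProducts A))
    {c x : A} {M : ℤ} (h : AlmostLE c M) (hc : c ∈ L) (hcs : star c = c) (hx : x ∈ L)
    (hx0 : Pos x) : Pos (M • x - c * x) := by
  rcases hCond with hCond | ⟨⟨u, hu⟩, hprod⟩
  · have hxL : x ∈ fractions (sumSquares (L : Set A)) := by
      rw [← hCond]; exact mem_positives_iff.2 ⟨hx, hx0⟩
    obtain ⟨n, hn, hn'⟩ := hxL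
    refine Pos.of_nsmul hn ?_
    rw [smul_sub, smul_comm, ← mul_smul_comm]
    generalize n • x = y at hn'
    induction hn' using AddSubsemigroup.closure_induction with
    | mem y hy =>
      obtain ⟨d, hd, rfl⟩ := hy
      have := h.pos_conj hArch (star d)
      rwa [star_star, hL.mul_comm _ (hL.star_mem d hd) _ hc, mul_assoc] at this
    | add y z _ _ hy hz =>
      convert hy.add hz using 1
      rw [mul_add]; module
  · have hus : star u = u := by
      have h1 := (hu (star u)).1
      have h2 := congrArg star h1
      rw [star_mul, star_star, (hu _).1] at h2
      exact h2
    have h1 := h.pos_conj hArch u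
    rw [hus, (hu u).1, (hu c).1, (hu c).2] at h1
    have hxs := hx0.star_eq hInf
    have e : (M • u - c) * x = M • x - c * x := by
      rw [sub_mul, smul_mul_assoc, (hu x).1]
    have := hprod _ (mem_positives_iff.2 ⟨trivial, h1⟩) x
      (mem_positives_iff.2 ⟨trivial, hx0⟩) (by
        rw [e, star_sub, star_zsmul, star_mul, hxs, hcs, hL.mul_comm x hx c hc])
    rw [e] at this
    exact (mem_positives_iff.1 this).2

end PositiveCone

end WeylStar

/-! ### Lattice-ordered rings with bounded multiplication. -/

namespace WeylStar

section LatticeOrdered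

variable {R : Type*} [NonUnitalCommRing R] [Lattice R] [IsOrderedAddMonoid R]

variable (R) in
/-- A lattice ordered ring in which positive elements act as bounded positive operators. -/
structure IsBoundedLatticeRing : Prop where
  mul_nonneg : ∀ a b : R, 0 ≤ a → 0 ≤ b → 0 ≤ a * b
  bounded : ∀ c : R, 0 ≤ c → ∃ m : ℕ, ∀ x : R, 0 ≤ x → c * x ≤ m • x

theorem nsmul_inf_eq_zero {a b : R} (ha : 0 ≤ a) (hb : 0 ≤ b) (h : a ⊓ b = 0) (n : ℕ) :
    n • a ⊓ b = 0 := by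
  induction n with
  | zero => simpa using hb
  | succ n ih =>
    refine le_antisymm ?_ (le_inf (nsmul_nonneg ha _) hb)
    have h1 : (n • a ⊓ b) + (a ⊓ b) = 0 := by rw [ih, h, add_zero]
    rw [← h1, add_inf, inf_add, inf_add, succ_nsmul]
    have h2 : b ≤ b + b := le_add_of_nonneg_left hb
    have h3 : b ≤ n • a + b := le_add_of_nonneg_left (nsmul_nonneg ha _)
    have h4 : b ≤ b + a := le_add_of_nonneg_right ha
    refine le_inf (le_inf inf_le_left (inf_le_right.trans h4))
      (le_inf (inf_le_right.trans h3) (inf_le_right.trans h2))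

/-- An element that `x` fixes still fixes what lies below, when `x` is a contraction. -/
theorem mul_eq_self_of_le {f g x : R} (hx : ∀ y : R, 0 ≤ y → x * y ≤ y) (hf : 0 ≤ f)
    (hfg : f ≤ g) (hg : g * x = g) : f * x = f := by
  refine le_antisymm (by rw [mul_comm]; exact hx f hf) ?_
  have h := hx (g - f) (sub_nonneg.2 hfg)
  rw [mul_sub, mul_comm x g, hg, mul_comm x f] at h
  exact (sub_le_sub_iff_left g).1 h

namespace IsBoundedLatticeRing

variable (hR : IsBoundedLatticeRing R)
include hR

theorem mul_le_mul_left' {a b c : R} (hc : 0 ≤ c) (h : a ≤ b) : c * a ≤ c * b := by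
  rw [← sub_nonneg, ← mul_sub]
  exact hR.mul_nonneg _ _ hc (sub_nonneg.2 h)

theorem mul_inf_mul_eq_zero {a b c : R} (hc : 0 ≤ c) (ha : 0 ≤ a) (hb : 0 ≤ b) (h : a ⊓ b = 0) :
    c * a ⊓ c * b = 0 := by
  obtain ⟨m, hm⟩ := hR.bounded c hc
  refine le_antisymm ?_ (le_inf (hR.mul_nonneg _ _ hc ha) (hR.mul_nonneg _ _ hc hb))
  refine (inf_le_inf (hm a ha) (hm b hb)).trans (le_of_eq ?_)
  refine nsmul_inf_eq_zero ha (nsmul_nonneg hb _) ?_ m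
  rw [inf_comm] at h ⊢
  exact nsmul_inf_eq_zero hb ha h m

/-- Subtracting `a ⊓ b` makes the two elements disjoint, and bounded multiplication preserves
disjointness. -/
theorem mul_inf {a b c : R} (hc : 0 ≤ c) : c * (a ⊓ b) = c * a ⊓ c * b := by
  have h : (a - a ⊓ b) ⊓ (b - a ⊓ b) = 0 := by rw [← inf_sub, sub_self]
  have h1 := hR.mul_inf_mul_eq_zero hc (sub_nonneg.2 inf_le_left) (sub_nonneg.2 inf_le_right) h
  rw [mul_sub, mul_sub, ← inf_sub, sub_eq_zero] at h1
  exact h1.symm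

theorem mul_posPart {x c : R} (hc : 0 ≤ c) : c * x⁺ = (c * x)⁺ := by
  have e : ∀ y : R, y⁺ = y - y ⊓ 0 := fun y => by
    have := inf_add_sup y 0
    rw [posPart_def, eq_sub_iff_add_eq, add_comm, this, add_zero]
  rw [e, e, mul_sub, hR.mul_inf hc, mul_zero]

theorem posPart_mul_nonneg (x : R) : 0 ≤ x⁺ * x := by
  have h : x⁺ * x = (x⁺ * x⁺) - x⁺ * x⁻ := by
    rw [← mul_sub, posPart_sub_negPart]
  -- The product lies below a multiple of each factor, and multiples of disjoint elements are
  -- disjoint.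
  have h0 : x⁺ * x⁻ = 0 := by
    obtain ⟨m, hm⟩ := hR.bounded x⁺ (posPart_nonneg x)
    obtain ⟨n, hn⟩ := hR.bounded x⁻ (negPart_nonneg x)
    have h1 : x⁺ * x⁻ ≤ n • x⁺ ⊓ m • x⁻ :=
      le_inf (by rw [mul_comm]; exact hn _ (posPart_nonneg x)) (hm _ (negPart_nonneg x))
    refine le_antisymm (h1.trans (le_of_eq ?_))
      (hR.mul_nonneg _ _ (posPart_nonneg x) (negPart_nonneg x))
    refine nsmul_inf_eq_zero (posPart_nonneg x) (nsmul_nonneg (negPart_nonneg x) _) ?_ n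
    rw [inf_comm]
    refine nsmul_inf_eq_zero (negPart_nonneg x) (posPart_nonneg x) ?_ m
    rw [inf_comm, posPart_inf_negPart_eq_zero]
  rw [h, h0, sub_zero]
  exact hR.mul_nonneg _ _ (posPart_nonneg x) (posPart_nonneg x)

theorem mul_eq_zero_of_le {f g x : R} (hx : 0 ≤ x) (hf : 0 ≤ f) (hfg : f ≤ g) (hg : x * g = 0) :
    x * f = 0 :=
  le_antisymm (hg ▸ hR.mul_le_mul_left' hx hfg) (hR.mul_nonneg _ _ hx hf)

/-- The truncation `2 (r - u)⁺ ⊓ r` fixes `(r - 2 u)⁺`. -/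
theorem posPart_mul_truncation {r u : R} (hr : ∀ y : R, 0 ≤ y → r * y ≤ y) (hu : 0 ≤ u)
    (h : (r - u)⁺ * r = (r - u)⁺) :
    (r - 2 • u)⁺ * (2 • (r - u)⁺ ⊓ r) = (r - 2 • u)⁺ := by
  set y := (r - 2 • u)⁺ with hy
  have hy0 : 0 ≤ y := posPart_nonneg _
  have hle : r - 2 • u ≤ r - u := by
    rw [two_nsmul]; exact sub_le_sub_left (le_add_of_nonneg_left hu) r
  have hyr : y * r = y := mul_eq_self_of_le hr hy0 (posPart_mono hle) h
  have h1 : 0 ≤ y * (r - 2 • u) := hR.posPart_mul_nonneg _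
  rw [hR.mul_inf hy0, hyr, inf_eq_right, mul_smul_comm]
  -- Since `y * r = y`, nonnegativity of `y * (r - 2 • u)` reads `2 y u ≤ y`, that is `y ≤ 2 y (r -
  -- u)`.
  have h2 : y * (r - u) ≤ y * (r - u)⁺ := hR.mul_le_mul_left' hy0 (le_posPart _)
  refine le_trans ?_ (nsmul_le_nsmul_right h2 2)
  rw [mul_sub, hyr] at h1 ⊢
  rw [mul_smul_comm] at h1
  rw [← sub_nonneg]
  convert h1 using 1
  module

end IsBoundedLatticeRing

end LatticeOrdered

end WeylStar

/-! ### Filters, ultrafilters and the topology they carry. -/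

namespace WeylStar

section Filters

variable {A : Type*} [NonUnitalRing A] [StarRing A] {S E : Set A}

theorem StarDom.trans (hSE : IsWeylStarSemigroup S E) {a b c : A} (hab : StarDom E a b)
    (hbc : StarDom E b c) : StarDom E a c := by
  obtain ⟨h1, h2⟩ := hab
  obtain ⟨h3, h4⟩ := hbc
  unfold Compat Dom at *
  constructor
  · have := hSE.isStarSubsemigroup_sub.mul_mem _ h3 _ h1
    unfold Compat
    convert this using 1
    conv_lhs => rw [h2]
    simp [mul_assoc]
  · unfold Dom
    conv_rhs => rw [h2]
    rw [mul_assoc, mul_assoc (star b), ← h4, ← h2]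

theorem star_starSquares {p : A} (hp : p ∈ starSquares S) : star p = p := by
  obtain ⟨a, -, rfl⟩ := hp
  simp

theorem IsWeylStarSemigroup.conj_mem (hSE : IsWeylStarSemigroup S E) {a e : A} (ha : a ∈ S)
    (he : e ∈ E) : a * e * star a ∈ E := by
  simpa using hSE.star_normal _ (hSE.isStarSubsemigroup.star_mem a ha) e he

theorem IsStarFilter.mem_of_starDom {U : Set A} (hU : IsStarFilter S E U) {a b : A}
    (ha : a ∈ U) (hb : b ∈ S) (h : StarDom E a b) : b ∈ U :=
  ((hU.mem_iff b hb b hb).2 ⟨a, ha, h, h⟩).1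

theorem IsStarFilter.exists_common {U : Set A} (hU : IsStarFilter S E U) {a b : A}
    (ha : a ∈ U) (hb : b ∈ U) : ∃ c ∈ U, StarDom E c a ∧ StarDom E c b :=
  (hU.mem_iff a (hU.subset ha) b (hU.subset hb)).1 ⟨ha, hb⟩

theorem IsStarFilter.exists_starDom {U : Set A} (hU : IsStarFilter S E U) {a : A}
    (ha : a ∈ U) : ∃ c ∈ U, StarDom E c a := by
  obtain ⟨c, hc, h, -⟩ := hU.exists_common ha ha
  exact ⟨c, hc, h⟩

theorem zero_starDom (h0 : (0 : A) ∈ E) (a : A) : StarDom E 0 a := by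
  constructor
  · simpa [Compat] using h0
  · simp [Dom]

theorem IsStarFilter.zero_notMem {U : Set A} (h0 : (0 : A) ∈ E) (hU : IsStarFilter S E U)
    (hne : U ≠ S) : (0 : A) ∉ U := fun h =>
  hne (hU.subset.antisymm fun _ ha => hU.mem_of_starDom h ha (zero_starDom h0 _))

/-- Zero is `≾` everything, so a filter is proper exactly when it omits zero, a condition stable
under unions of chains; Zorn's lemma applies. -/
theorem exists_isStarUltrafilter (h0 : (0 : A) ∈ E) (h0S : (0 : A) ∈ S) {U : Set A}
    (hU : IsStarFilter S E U) (h : (0 : A) ∉ U) : ∃ V, IsStarUltrafilter S E V ∧ U ⊆ V := by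
  obtain ⟨V, hUV, hV⟩ := zorn_subset_nonempty {V : Set A | IsStarFilter S E V ∧ (0 : A) ∉ V} (by
    intro c hc hchain hne
    refine ⟨⋃₀ c, ⟨⟨?_, ?_, ?_⟩, ?_⟩, fun s hs => Set.subset_sUnion_of_mem hs⟩
    · exact Set.sUnion_subset fun s hs => (hc hs).1.subset
    · obtain ⟨s, hs⟩ := hne
      exact (hc hs).1.nonempty.mono (Set.subset_sUnion_of_mem hs)
    · intro a ha b hb
      constructor
      · rintro ⟨⟨s, hs, has⟩, ⟨t, ht, hbt⟩⟩
        rcases hchain.total hs ht with hst | hst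
        · obtain ⟨d, hd, h'⟩ := (hc ht).1.exists_common (hst has) hbt
          exact ⟨d, ⟨t, ht, hd⟩, h'⟩
        · obtain ⟨d, hd, h'⟩ := (hc hs).1.exists_common has (hst hbt)
          exact ⟨d, ⟨s, hs, hd⟩, h'⟩
      · rintro ⟨d, ⟨s, hs, hd⟩, h1, h2⟩
        exact ⟨⟨s, hs, (hc hs).1.mem_of_starDom hd ha h1⟩,
          ⟨s, hs, (hc hs).1.mem_of_starDom hd hb h2⟩⟩
    · rintro ⟨s, hs, h0s⟩
      exact (hc hs).2 h0s) U ⟨hU, h⟩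
  refine ⟨V, ⟨hV.prop.1, fun e => hV.prop.2 (e ▸ h0S), fun W hW hne hVW => ?_⟩, hUV⟩
  exact (hV.eq_of_subset (show W ∈ {V : Set A | IsStarFilter S E V ∧ (0 : A) ∉ V} from
    ⟨hW, hW.zero_notMem h0 hne⟩) hVW).symm

theorem WeylGroupoid.exists_basicOpen_subset {O : Set (WeylGroupoid S E)} (hO : IsOpen O)
    {U : WeylGroupoid S E} (hU : U ∈ O) :
    ∃ a ∈ U.1, WeylGroupoid.basicOpen S E a ⊆ O := by
  induction hO generalizing U with
  | basic s hs =>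
    obtain ⟨a, -, rfl⟩ := hs
    exact ⟨a, hU, subset_rfl⟩
  | univ =>
    obtain ⟨a, ha⟩ := U.2.isStarFilter.nonempty
    exact ⟨a, ha, Set.subset_univ _⟩
  | inter s t _ _ hs ht =>
    obtain ⟨a, ha, has⟩ := hs hU.1
    obtain ⟨b, hb, hbt⟩ := ht hU.2
    obtain ⟨c, hc, h1, h2⟩ := U.2.isStarFilter.exists_common ha hb
    have hS := U.2.isStarFilter.subset
    exact ⟨c, hc, fun V hV => ⟨has (V.2.isStarFilter.mem_of_starDom hV (hS ha) h1),
      hbt (V.2.isStarFilter.mem_of_starDom hV (hS hb) h2)⟩⟩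
  | sUnion c _ ih =>
    obtain ⟨s, hs, hUs⟩ := hU
    obtain ⟨a, ha, h⟩ := ih s hs hUs
    exact ⟨a, ha, h.trans (Set.subset_sUnion_of_mem hs)⟩

theorem WeylGroupoid.isOpen_basicOpen {a : A} (ha : a ∈ S) :
    IsOpen (WeylGroupoid.basicOpen S E a) :=
  TopologicalSpace.isOpen_generateFrom_of_mem ⟨a, ha, rfl⟩

end Filters

/-! ### Traces of filters on the diagonal ring. -/

section Diagonal

variable {A : Type*} [NonUnitalRing A] [StarRing A] {S E : Set A}
variable {R : Type*} [NonUnitalCommRing R] [Lattice R] [IsOrderedAddMonoid R]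

/-- `φ` embeds a bounded lattice ordered ring as a hereditary ring around the `*`-squares. -/
structure IsDiagonal (S : Set A) (φ : R →ₙ+* A) : Prop where
  isBounded : IsBoundedLatticeRing R
  injective : Function.Injective φ
  exists_eq : ∀ s ∈ S, ∃ p, φ p = star s * s
  nonneg : ∀ p, φ p ∈ starSquares S → 0 ≤ p
  mul_le : ∀ p, φ p ∈ starSquares S → ∀ x, 0 ≤ x → p * x ≤ x
  mem_of_le : ∀ a p, 0 ≤ a → a ≤ p → φ p ∈ starSquares S → φ a ∈ S
  star_map : ∀ a, star (φ a) = φ a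

/-- The `*`-squares cutting `a` down to an element of `V`. -/
structure MemTrace (S V : Set A) (φ : R →ₙ+* A) (a : A) (r y : R) : Prop where
  mem : a * φ y ∈ V
  sq : φ y ∈ starSquares S
  mul_eq : y * r = y

namespace IsDiagonal

variable {φ : R →ₙ+* A} (hφ : IsDiagonal S φ) (hSE : IsWeylStarSemigroup S E)
include hφ

omit [IsOrderedAddMonoid R] in
theorem mul_eq_of_mul_mul {y z : R} (hy : φ y ∈ starSquares S) (hz : 0 ≤ z)
    (h : z * y * y = z) : z * y = z := by
  have h1 : z * y ≤ z := by rw [mul_comm]; exact hφ.mul_le y hy z hz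
  have h2 : z * y * y ≤ z * y := by
    rw [mul_comm (z * y)]
    exact hφ.mul_le y hy _ (hφ.isBounded.mul_nonneg _ _ hz (hφ.nonneg y hy))
  exact le_antisymm h1 (by rwa [h] at h2)

omit hφ in
theorem map_mem_E (hSE : IsWeylStarSemigroup S E) {y : A} (hy : y ∈ starSquares S) : y ∈ E :=
  (hSE.central_starSquares hy).1

omit [Lattice R] [IsOrderedAddMonoid R] hφ in
theorem mul_map_mem (hSE : IsWeylStarSemigroup S E) {a : A} (ha : a ∈ S) {y : R}
    (hy : φ y ∈ starSquares S) : a * φ y ∈ S :=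
  hSE.isStarSubsemigroup.mul_mem _ ha _ (hSE.sub_subset (map_mem_E hSE hy))

include hSE

omit [Lattice R] [IsOrderedAddMonoid R] hφ in
theorem mul_map_starDom_self {a : A} {r y : R} (ha : a ∈ S) (hr : φ r = star a * a)
    (hy : φ y ∈ starSquares S) (hyr : y * r = y) : StarDom E (a * φ y) a := by
  constructor
  · rw [Compat, star_mul, star_starSquares hy, ← mul_assoc]
    exact hSE.conj_mem ha (map_mem_E hSE hy)
  · rw [Dom, ← hr, mul_assoc, ← map_mul, hyr]

omit [Lattice R] [IsOrderedAddMonoid R] hφ in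
theorem mul_map_starDom_mul_map {a : A} {r y x : R} (ha : a ∈ S) (hr : φ r = star a * a)
    (hy : φ y ∈ starSquares S) (hx : φ x ∈ starSquares S) (hyr : y * r = y) (hyx : y * x = y) :
    StarDom E (a * φ y) (a * φ x) := by
  constructor
  · rw [Compat, star_mul, star_starSquares hy, mul_assoc, ← mul_assoc (φ x), ← map_mul,
      mul_comm x y, hyx, ← mul_assoc]
    exact hSE.conj_mem ha (map_mem_E hSE hy)
  · have e : star (a * φ x) * (a * φ x) = φ (x * r * x) := by
      rw [star_mul, star_starSquares hx, map_mul, map_mul, hr]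
      simp only [mul_assoc]
    rw [Dom, e, mul_assoc, ← map_mul, ← mul_assoc, ← mul_assoc, hyx, hyr, hyx]

omit [Lattice R] [IsOrderedAddMonoid R] hφ in
/-- If `c ≾ a, s` and `z = c⋆ c` then `a z ≾ s`. -/
theorem mul_map_starDom_of_starDom {a c s : A} {z : R} (hc : c ∈ S) (hz : φ z = star c * c)
    (hca : StarDom E c a) (hcs : StarDom E c s) : StarDom E (a * φ z) s := by
  constructor
  · have h1 := hSE.isStarSubsemigroup_sub.star_mem _ hca.1
    have h2 := hSE.isStarSubsemigroup_sub.mul_mem _ hcs.1 _ h1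
    have e : star (φ z) = φ z := star_starSquares ⟨c, hc, hz⟩
    rw [Compat, star_mul, e, hz]
    simpa [mul_assoc] using h2
  · rw [Dom, hz, mul_assoc, mul_assoc (star c), ← hcs.2]

omit [Lattice R] [IsOrderedAddMonoid R] hφ in
/-- If `c ≾ b ≾ a` and `q = b⋆ b` then `c ≾ a q`. -/
theorem starDom_mul_map {a b c : A} {q : R} (hb : b ∈ S) (hq : φ q = star b * b)
    (hba : StarDom E b a) (hcb : StarDom E c b) : StarDom E c (a * φ q) := by
  have hs : star (φ q) = φ q := star_starSquares ⟨b, hb, hq⟩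
  have hcq : c * φ q = c := by rw [hq]; exact hcb.2.symm
  have h1 := hSE.isStarSubsemigroup_sub.mul_mem _ hba.1 _
    (hcb.1)
  constructor
  · rw [Compat, hq]
    simpa [mul_assoc] using h1
  · have h2 : φ q * (star a * a) = φ q := by
      rw [hq, mul_assoc, ← hba.2]
    rw [Dom, star_mul, hs]
    rw [show φ q * star a * (a * φ q) = φ q * (star a * a) * φ q by simp only [mul_assoc], h2,
      ← mul_assoc, hcq, hcq]

omit [IsOrderedAddMonoid R] in
theorem memTrace_of_starDom {V : Set A} (hV : IsStarFilter S E V) {a c : A} {r : R} (ha : a ∈ V)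
    (hr : φ r = star a * a) (hc : c ∈ V) (hca : StarDom E c a) :
    ∃ z, φ z = star c * c ∧ MemTrace S V φ a r z := by
  have hcS := hV.subset hc
  obtain ⟨z, hz⟩ := hφ.exists_eq c hcS
  refine ⟨z, hz, ?_, ⟨c, hcS, hz⟩, ?_⟩
  · obtain ⟨d, hd, hdc⟩ := hV.exists_starDom hc
    exact hV.mem_of_starDom hd (mul_map_mem hSE (hV.subset ha) ⟨c, hcS, hz⟩)
      (starDom_mul_map hSE hcS hz hca hdc)
  · apply hφ.injective
    rw [map_mul, hz, hr, mul_assoc, ← hca.2]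

omit [Lattice R] [IsOrderedAddMonoid R] hφ in
theorem memTrace_mono {V : Set A} (hV : IsStarFilter S E V) {a : A} {r y x : R} (ha : a ∈ S)
    (hr : φ r = star a * a) (hy : MemTrace S V φ a r y) (hx : φ x ∈ starSquares S)
    (hxr : x * r = x) (hyx : y * x = y) : MemTrace S V φ a r x :=
  ⟨hV.mem_of_starDom hy.mem (mul_map_mem hSE ha hx)
    (mul_map_starDom_mul_map hSE ha hr hy.sq hx hy.mul_eq hyx), hx, hxr⟩

omit [IsOrderedAddMonoid R] in
-- The witness is `c⋆ c` for a common lower bound `c` of `a y` and `a y'`. Domination by `a x` only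
-- gives `z * x * x = z`, which the contraction property of `x` improves to `z * x = z`. Taking `y'
-- = y` is how elements of the trace are interpolated.
theorem memTrace_directed {V : Set A} (hV : IsStarFilter S E V) {a : A} {r y y' : R} (ha : a ∈ V)
    (hr : φ r = star a * a) (hy : MemTrace S V φ a r y) (hy' : MemTrace S V φ a r y') :
    ∃ z, MemTrace S V φ a r z ∧ z * y = z ∧ z * y' = z := by
  obtain ⟨c, hc, h1, h2⟩ := hV.exists_common hy.mem hy'.mem
  have haS := hV.subset ha
  obtain ⟨z, hz, hzt⟩ := hφ.memTrace_of_starDom hSE hV ha hr hc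
    (h1.trans hSE (mul_map_starDom_self hSE haS hr hy.sq hy.mul_eq))
  have hz0 := hφ.nonneg z hzt.sq
  have key : ∀ x, MemTrace S V φ a r x → StarDom E c (a * φ x) → z * x = z := by
    intro x hx h
    refine hφ.mul_eq_of_mul_mul hx.sq hz0 (hφ.injective ?_)
    have e : star (a * φ x) * (a * φ x) = φ (x * r * x) := by
      rw [star_mul, star_starSquares hx.sq, map_mul, map_mul, hr]
      simp only [mul_assoc]
    have h3 := h.2
    rw [Dom, e, hx.mul_eq] at h3
    rw [mul_assoc, map_mul, hz, mul_assoc, ← h3]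
  exact ⟨z, hzt, key y hy h1, key y' hy' h2⟩

omit [IsOrderedAddMonoid R] in
theorem exists_memTrace {V : Set A} (hV : IsStarFilter S E V) {a : A} {r : R} (ha : a ∈ V)
    (hr : φ r = star a * a) : ∃ z, MemTrace S V φ a r z := by
  obtain ⟨c, hc, hca⟩ := hV.exists_starDom ha
  obtain ⟨z, -, hz⟩ := hφ.memTrace_of_starDom hSE hV ha hr hc hca
  exact ⟨z, hz⟩

omit [Lattice R] [IsOrderedAddMonoid R] hφ in
theorem zero_mem_E (h0S : (0 : A) ∈ S) : (0 : A) ∈ E :=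
  map_mem_E hSE ⟨0, h0S, by simp⟩

omit [Lattice R] [IsOrderedAddMonoid R] hφ in
theorem memTrace_ne_zero (h0S : (0 : A) ∈ S) {V : Set A} (hV : IsStarUltrafilter S E V) {a : A}
    {r y : R} (hy : MemTrace S V φ a r y) : y ≠ 0 := by
  rintro rfl
  refine hV.isStarFilter.zero_notMem (zero_mem_E hSE h0S) hV.ne ?_
  simpa using hy.mem

end IsDiagonal

end Diagonal

end WeylStar

/-! ### Bumps, construction of ultrafilters, and compactness. -/

namespace WeylStar

section Compactness

variable {A : Type*} [NonUnitalRing A] [StarRing A] {S E : Set A}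
variable {R : Type*} [NonUnitalCommRing R] [Lattice R] [IsOrderedAddMonoid R]

/-- The squared truncation `(2 (r - u)⁺ ⊓ r)²`. -/
def bump (r u : R) : R := (2 • (r - u)⁺ ⊓ r) * (2 • (r - u)⁺ ⊓ r)

namespace IsDiagonal

variable {φ : R →ₙ+* A} (hφ : IsDiagonal S φ) (hSE : IsWeylStarSemigroup S E)
include hφ

omit [IsOrderedAddMonoid R] in
theorem zero_mem {s : A} (hs : s ∈ S) : (0 : A) ∈ S := by
  obtain ⟨p, hp⟩ := hφ.exists_eq s hs
  have hpS : φ p ∈ starSquares S := ⟨s, hs, hp⟩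
  simpa using hφ.mem_of_le 0 p le_rfl (hφ.nonneg p hpS) hpS

theorem bump_mem {r : R} (hr : φ r ∈ starSquares S) (u : R) : φ (bump r u) ∈ starSquares S := by
  have h0 : 0 ≤ 2 • (r - u)⁺ ⊓ r :=
    le_inf (nsmul_nonneg (posPart_nonneg _) _) (hφ.nonneg r hr)
  -- Truncating at `r` puts the element in `S` by heredity; being self-adjoint, its square is then a
  -- `*`-square. This is why the bump is squared.
  refine ⟨φ (2 • (r - u)⁺ ⊓ r), hφ.mem_of_le _ r h0 inf_le_right hr, ?_⟩
  rw [hφ.star_map, bump, map_mul]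

theorem bump_mul_eq {r u x : R} (hr : φ r ∈ starSquares S) (hx : φ x ∈ starSquares S)
    (h : (r - u)⁺ * x = (r - u)⁺) : bump r u * x = bump r u := by
  rw [bump, mul_assoc, mul_eq_self_of_le (hφ.mul_le x hx)
    (le_inf (nsmul_nonneg (posPart_nonneg _) _) (hφ.nonneg r hr)) inf_le_left
    (by rw [smul_mul_assoc, h])]

theorem mul_bump_eq_zero {r u z : R} (hr : φ r ∈ starSquares S) (hz : 0 ≤ z)
    (h : z * (r - u) ≤ 0) : z * bump r u = 0 := by
  have h1 : z * (r - u)⁺ = 0 := by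
    rw [hφ.isBounded.mul_posPart hz, posPart_eq_zero.2 h]
  rw [bump, ← mul_assoc, hφ.isBounded.mul_eq_zero_of_le hz
    (le_inf (nsmul_nonneg (posPart_nonneg _) _) (hφ.nonneg r hr)) inf_le_left
    (by rw [mul_smul_comm, h1, smul_zero]), zero_mul]

theorem posPart_mul_bump {r u : R} (hr : φ r ∈ starSquares S) (hu : 0 ≤ u)
    (h : (r - u)⁺ * r = (r - u)⁺) : (r - 2 • u)⁺ * bump r u = (r - 2 • u)⁺ := by
  have h1 := hφ.isBounded.posPart_mul_truncation (hφ.mul_le r hr) hu h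
  rw [bump, ← mul_assoc, h1, h1]

theorem posPart_mul_eq_of_le {r u v x : R} (hx : φ x ∈ starSquares S)
    (h : (r - u)⁺ * x = (r - u)⁺) (huv : u ≤ v) : (r - v)⁺ * x = (r - v)⁺ :=
  mul_eq_self_of_le (hφ.mul_le x hx) (posPart_nonneg _) (posPart_mono (sub_le_sub_left huv r)) h

include hSE

/-- A family of nontrivial remainders `(r - u)⁺` generates an ultrafilter. -/
theorem exists_ultrafilter (h0S : (0 : A) ∈ S) {a : A} {r : R} (ha : a ∈ S)
    (hr : φ r = star a * a) (T : Set R) (hT0 : ∀ u ∈ T, 0 ≤ u)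
    (hTadd : ∀ u ∈ T, ∀ v ∈ T, u + v ∈ T) {u₀ : R} (hu₀ : u₀ ∈ T)
    (hu₀r : (r - u₀)⁺ * r = (r - u₀)⁺) (hT : ∀ u ∈ T, ¬ r ≤ u) :
    ∃ V, IsStarUltrafilter S E V ∧ a ∈ V ∧ ∀ x, φ x ∈ starSquares S → x * r = x →
      (∃ u ∈ T, (r - u)⁺ * x = (r - u)⁺) → a * φ x ∈ V := by
  have hrS : φ r ∈ starSquares S := ⟨a, ha, hr⟩
  set G : Set R := {x | φ x ∈ starSquares S ∧ x * r = x ∧ ∃ u ∈ T, (r - u)⁺ * x = (r - u)⁺}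
  -- The bump at `u` is the identity only on `(r - 2 • u)⁺`, so closure of `T` under doubling is
  -- needed.
  have hbump : ∀ u ∈ T, (r - u)⁺ * r = (r - u)⁺ → bump r u ∈ G := fun u hu h =>
    ⟨hφ.bump_mem hrS u, hφ.bump_mul_eq hrS hrS h, 2 • u,
      by rw [two_nsmul]; exact hTadd u hu u hu, hφ.posPart_mul_bump hrS (hT0 u hu) h⟩
  have hdir : ∀ x ∈ G, ∀ y ∈ G, ∃ z ∈ G, z * x = z ∧ z * y = z := by
    rintro x ⟨hx, hxr, u, hu, hux⟩ y ⟨hy, hyr, v, hv, hvy⟩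
    -- Adding `u₀` keeps the remainder inside the part on which `r` is the identity.
    have hw : u + v + u₀ ∈ T := hTadd _ (hTadd u hu v hv) _ hu₀
    have h1 : u ≤ u + v + u₀ := by
      rw [add_assoc]; exact le_add_of_nonneg_right (add_nonneg (hT0 v hv) (hT0 _ hu₀))
    have h2 : v ≤ u + v + u₀ := by
      rw [add_right_comm]; exact le_add_of_nonneg_left (add_nonneg (hT0 u hu) (hT0 _ hu₀))
    have h3 : u₀ ≤ u + v + u₀ := le_add_of_nonneg_left (add_nonneg (hT0 u hu) (hT0 v hv))
    refine ⟨bump r (u + v + u₀), hbump _ hw (hφ.posPart_mul_eq_of_le hrS hu₀r h3), ?_, ?_⟩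
    · exact hφ.bump_mul_eq hrS hx (hφ.posPart_mul_eq_of_le hx hux h1)
    · exact hφ.bump_mul_eq hrS hy (hφ.posPart_mul_eq_of_le hy hvy h2)
  have hdom : ∀ x ∈ G, ∀ y ∈ G, x * y = x → StarDom E (a * φ x) (a * φ y) :=
    fun x hx y hy h => mul_map_starDom_mul_map hSE ha hr hx.1 hy.1 hx.2.1 h
  have hmemG : ∀ x ∈ G, a * φ x ∈ {s | s ∈ S ∧ ∃ x ∈ G, StarDom E (a * φ x) s} := by
    intro x hx
    obtain ⟨z, hz, hzx, -⟩ := hdir x hx x hx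
    exact ⟨mul_map_mem hSE ha hx.1, z, hz, hdom z hz x hx hzx⟩
  have hself : ∀ x ∈ G, StarDom E (a * φ x) a := fun x hx =>
    mul_map_starDom_self hSE ha hr hx.1 hx.2.1
  have hF : IsStarFilter S E {s | s ∈ S ∧ ∃ x ∈ G, StarDom E (a * φ x) s} := by
    refine ⟨fun s hs => hs.1, ⟨_, hmemG _ (hbump u₀ hu₀ hu₀r)⟩, fun s hs t ht => ?_⟩
    constructor
    · rintro ⟨⟨-, x, hx, hxs⟩, ⟨-, y, hy, hyt⟩⟩
      obtain ⟨z, hz, hzx, hzy⟩ := hdir x hx y hy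
      exact ⟨a * φ z, hmemG z hz, (hdom z hz x hx hzx).trans hSE hxs,
        (hdom z hz y hy hzy).trans hSE hyt⟩
    · rintro ⟨c, ⟨-, x, hx, hxc⟩, hcs, hct⟩
      exact ⟨⟨hs, x, hx, hxc.trans hSE hcs⟩, ⟨ht, x, hx, hxc.trans hSE hct⟩⟩
  have h0 : (0 : A) ∉ {s | s ∈ S ∧ ∃ x ∈ G, StarDom E (a * φ x) s} := by
    rintro ⟨-, x, ⟨-, hxr, u, hu, hux⟩, hx⟩
    have h1 : a * φ x = 0 := by simpa [Dom] using hx.2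
    have h2 : x = 0 := by
      apply hφ.injective
      rw [← hxr, mul_comm, map_mul, hr, mul_assoc, h1, mul_zero, map_zero]
    rw [h2, mul_zero, eq_comm, posPart_eq_zero, sub_nonpos] at hux
    exact hT u hu hux
  obtain ⟨V, hV, hFV⟩ := exists_isStarUltrafilter (zero_mem_E hSE h0S) h0S hF h0
  refine ⟨V, hV, hFV ⟨ha, _, hbump u₀ hu₀ hu₀r, hself _ (hbump u₀ hu₀ hu₀r)⟩, ?_⟩
  exact fun x hx hxr hu => hFV (hmemG x ⟨hx, hxr, hu⟩)

/-- If `d ≺ e' ≺ e` and `a e` is not in the ultrafilter `V`, then `d` is disjoint from an element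
of the trace of `V`. -/
theorem exists_memTrace_mul_eq_zero (h0S : (0 : A) ∈ S) {V : Set A}
    (hV : IsStarUltrafilter S E V) {a : A} {r d e' e : R} (ha : a ∈ V) (hr : φ r = star a * a)
    (hd : φ d ∈ starSquares S) (he' : φ e' ∈ starSquares S) (he : φ e ∈ starSquares S)
    (hde : d * e' = d) (hee : e' * e = e') (her : e * r = e) (hnot : a * φ e ∉ V) :
    ∃ v, MemTrace S V φ a r v ∧ v * d = 0 := by
  by_contra! hne
  have haS := hV.isStarFilter.subset ha
  have hB := hφ.isBounded
  have hrS : φ r ∈ starSquares S := ⟨a, haS, hr⟩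
  have he'r : e' * r = e' := by rw [← hee, mul_assoc, her]
  have hle : ∀ y, φ y ∈ starSquares S → y * r = y → y ≤ r := fun y hy hyr => by
    rw [← hyr]; exact hφ.mul_le y hy r (hφ.nonneg r hrS)
  have hd0 := hφ.nonneg d hd
  -- These `u` vanish on `d` near `V`. The ultrafilter `W` they generate contains both `V` and `a
  -- e`, against maximality of `V`.
  set T : Set R := {u | 0 ≤ u ∧ ∃ v, MemTrace S V φ a r v ∧ v * d * u = 0}
  have hrest : ∀ y, φ y ∈ starSquares S → (r - (r - y))⁺ = y := fun y hy => by
    rw [sub_sub_cancel, posPart_of_nonneg (hφ.nonneg y hy)]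
  have hu₀ : r - e' ∈ T := by
    refine ⟨sub_nonneg.2 (hle e' he' he'r), ?_⟩
    obtain ⟨v, hv⟩ := hφ.exists_memTrace hSE hV.isStarFilter ha hr
    refine ⟨v, hv, ?_⟩
    rw [mul_assoc, mul_sub, hde, ← hde, mul_assoc, he'r, sub_self, mul_zero]
  obtain ⟨W, hW, haW, hWx⟩ := hφ.exists_ultrafilter hSE h0S haS hr T (fun u hu => hu.1)
    (by
      rintro u ⟨hu, v, hv, hvu⟩ u' ⟨hu', v', hv', hvu'⟩
      obtain ⟨w, hw, hwv, hwv'⟩ := hφ.memTrace_directed hSE hV.isStarFilter ha hr hv hv'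
      refine ⟨add_nonneg hu hu', w, hw, ?_⟩
      have h1 : w * d * u = 0 := by rw [← hwv, mul_assoc w v, mul_assoc w, hvu, mul_zero]
      have h2 : w * d * u' = 0 := by rw [← hwv', mul_assoc w v', mul_assoc w, hvu', mul_zero]
      rw [mul_add, h1, h2, add_zero])
    hu₀ (by rw [hrest e' he', he'r]) (by
      rintro u ⟨hu, v, hv, hvu⟩ hru
      have h0 : 0 ≤ v * d := hB.mul_nonneg _ _ (hφ.nonneg v hv.sq) hd0
      have h1 := hB.mul_le_mul_left' h0 hru
      rw [hvu, mul_right_comm, hv.mul_eq] at h1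
      exact hne v hv (le_antisymm h1 h0))
  have heW : a * φ e ∈ W := hWx e he her ⟨r - e', hu₀, by rw [hrest e' he', hee]⟩
  have hVW : V ⊆ W := by
    intro s hs
    obtain ⟨c, hc, hca, hcs⟩ := hV.isStarFilter.exists_common ha hs
    obtain ⟨z, hz, hzt⟩ := hφ.memTrace_of_starDom hSE hV.isStarFilter ha hr hc hca
    obtain ⟨y, hy, hyz, -⟩ := hφ.memTrace_directed hSE hV.isStarFilter ha hr hzt hzt
    obtain ⟨v, hv, hvy, -⟩ := hφ.memTrace_directed hSE hV.isStarFilter ha hr hy hy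
    refine hW.isStarFilter.mem_of_starDom (hWx z hzt.sq hzt.mul_eq ⟨r - y, ?_, ?_⟩)
      (hV.isStarFilter.subset hs)
      (mul_map_starDom_of_starDom hSE (hV.isStarFilter.subset hc) hz hca hcs)
    · refine ⟨sub_nonneg.2 (hle y hy.sq hy.mul_eq), v, hv, ?_⟩
      rw [mul_right_comm, mul_sub, hv.mul_eq, hvy, sub_self, zero_mul]
    · rw [hrest y hy.sq, hyz]
  exact hnot (hV.maximal W hW.isStarFilter hW.ne hVW ▸ heW)

/-- The ultrafilters containing `a` that are in the closed region where `q` attains `r`. -/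
def region (S E : Set A) (φ : R →ₙ+* A) (a : A) (r q : R) : Set (WeylGroupoid S E) :=
  {V | a ∈ V.1 ∧ ∀ x, φ x ∈ starSquares S → x * r = x →
    (∃ k : ℕ, (r - k • (r - q))⁺ * x = (r - k • (r - q))⁺) → a * φ x ∈ V.1}

/-- Some `y` in the trace satisfies `y * q = y = y * r`, so `y` kills `r - q` and is fixed by every
`(r - k • (r - q))⁺`, hence by every `x` in question. -/
theorem basicOpen_subset_region {a b : A} {r q : R} (ha : a ∈ S) (hr : φ r = star a * a)
    (hq : φ q = star b * b) (hba : StarDom E b a) :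
    WeylGroupoid.basicOpen S E b ⊆ region S E φ a r q := by
  intro V (hbV : b ∈ V.1)
  have hV := V.2.isStarFilter
  have haV : a ∈ V.1 := hV.mem_of_starDom hbV ha hba
  refine ⟨haV, fun x hx hxr ⟨k, hk⟩ => ?_⟩
  obtain ⟨z, hz, hzt⟩ := hφ.memTrace_of_starDom hSE hV haV hr hbV hba
  obtain rfl : z = q := hφ.injective (hz.trans hq.symm)
  obtain ⟨y, hy, hyz, -⟩ := hφ.memTrace_directed hSE hV haV hr hzt hzt
  refine (memTrace_mono hSE hV ha hr hy hx hxr ?_).mem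
  have h1 : y * (r - k • (r - z))⁺ = y := by
    rw [hφ.isBounded.mul_posPart (hφ.nonneg y hy.sq), mul_sub, mul_smul_comm, mul_sub, hyz,
      hy.mul_eq, sub_self, smul_zero, sub_zero, posPart_of_nonneg (hφ.nonneg y hy.sq)]
  rw [← h1, mul_assoc, hk]

theorem isCompact_region (h0S : (0 : A) ∈ S) {a b : A} {r q : R} (ha : a ∈ S) (hb : b ∈ S)
    (hr : φ r = star a * a) (hq : φ q = star b * b) (hba : StarDom E b a) :
    IsCompact (region S E φ a r q) := by
  have hB := hφ.isBounded
  have hrS : φ r ∈ starSquares S := ⟨a, ha, hr⟩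
  have hqS : φ q ∈ starSquares S := ⟨b, hb, hq⟩
  have hqr : q * r = q := by
    apply hφ.injective
    rw [map_mul, hq, hr, mul_assoc, ← hba.2]
  have hle : ∀ y, φ y ∈ starSquares S → y * r = y → y ≤ r := fun y hy hyr => by
    rw [← hyr]; exact hφ.mul_le y hy r (hφ.nonneg r hrS)
  have hrq : 0 ≤ r - q := sub_nonneg.2 (hle q hqS hqr)
  refine isCompact_of_finite_subcover ?_
  intro ι O hO hcov
  by_contra! hfin

  set T : Set R := {u | 0 ≤ u ∧ ∃ t : Finset ι, ∀ V ∈ region S E φ a r q, V ∉ ⋃ j ∈ t, O j →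
    ∃ v, MemTrace S V.1 φ a r v ∧ ∃ k : ℕ, v * u ≤ k • (v * (r - q))}
  have hTadd : ∀ u ∈ T, ∀ v ∈ T, u + v ∈ T := by
    classical
    rintro u ⟨hu, t, ht⟩ u' ⟨hu', t', ht'⟩
    refine ⟨add_nonneg hu hu', t ∪ t', fun V hV hVn => ?_⟩
    rw [Finset.set_biUnion_union, Set.mem_union, not_or] at hVn
    obtain ⟨v, hv, k, hk⟩ := ht V hV hVn.1
    obtain ⟨v', hv', k', hk'⟩ := ht' V hV hVn.2
    obtain ⟨w, hw, hwv, hwv'⟩ := hφ.memTrace_directed hSE V.2.isStarFilter hV.1 hr hv hv'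
    have hw0 := hφ.nonneg w hw.sq
    have key : ∀ (u v : R) (k : ℕ), w * v = w → v * u ≤ k • (v * (r - q)) →
        w * u ≤ k • (w * (r - q)) := by
      intro u v k hwv h
      have := hB.mul_le_mul_left' hw0 h
      rwa [← mul_assoc, mul_smul_comm, ← mul_assoc, hwv] at this
    refine ⟨w, hw, k + k', ?_⟩
    rw [mul_add, add_smul]
    exact add_le_add (key u v k hwv hk) (key u' v' k' hwv' hk')
  have hu₀ : r - q ∈ T := by
    refine ⟨hrq, ∅, fun V hV _ => ?_⟩
    obtain ⟨v, hv⟩ := hφ.exists_memTrace hSE V.2.isStarFilter hV.1 hr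
    exact ⟨v, hv, 1, by rw [one_smul]⟩
  have hu₀r : (r - (r - q))⁺ * r = (r - (r - q))⁺ := by
    rw [sub_sub_cancel, posPart_of_nonneg (hφ.nonneg q hqS), hqr]
  have h0T : (0 : R) ∈ T := by
    refine ⟨le_rfl, ∅, fun V hV _ => ?_⟩
    obtain ⟨v, hv⟩ := hφ.exists_memTrace hSE V.2.isStarFilter hV.1 hr
    exact ⟨v, hv, 0, by simp⟩
  have hTmul : ∀ k : ℕ, k • (r - q) ∈ T := by
    intro k
    induction k with
    | zero => rwa [zero_smul]
    | succ k ih => rw [succ_nsmul]; exact hTadd _ ih _ hu₀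
  have hTprop : ∀ u ∈ T, ¬ r ≤ u := by
    rintro u ⟨hu, t, ht⟩ hru
    refine hfin t fun V hV => ?_
    by_contra hVn
    obtain ⟨v, hv, k, hk⟩ := ht V hV hVn
    have hv0 := hφ.nonneg v hv.sq
    have hk1 : 0 ≤ k • (r - q) := nsmul_nonneg hrq k
    -- Using `k + 1` instead of `k` guarantees at least one copy of `r - q`, so that `r` fixes the
    -- remainder even when `k = 0`.
    have hu1 : r - q ≤ (k + 1) • (r - q) := by
      rw [succ_nsmul]; exact le_add_of_nonneg_left hk1
    have h1 : v * (r - (k + 1) • (r - q)) ≤ 0 := by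
      rw [mul_sub, sub_nonpos, mul_smul_comm]
      refine (hB.mul_le_mul_left' hv0 hru).trans (hk.trans ?_)
      rw [succ_nsmul]
      exact le_add_of_nonneg_right (hB.mul_nonneg _ _ hv0 hrq)
    have h2 := hφ.posPart_mul_eq_of_le hrS hu₀r hu1
    have h3 := hφ.posPart_mul_bump hrS (nsmul_nonneg hrq _) h2
    rw [smul_smul] at h3
    have hxr := hφ.bump_mul_eq hrS hrS h2
    have hx : MemTrace S V.1 φ a r (bump r ((k + 1) • (r - q))) :=
      ⟨hV.2 _ (hφ.bump_mem hrS _) hxr ⟨_, h3⟩, hφ.bump_mem hrS _, hxr⟩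
    obtain ⟨w, hw, hwv, hwx⟩ := hφ.memTrace_directed hSE V.2.isStarFilter hV.1 hr hv hx
    -- `v` kills the bump although both belong to the trace of `V`; a common refinement `w` would be
    -- zero.
    refine memTrace_ne_zero hSE h0S V.2 hw ?_
    rw [← hwx, ← hwv, mul_assoc, hφ.mul_bump_eq_zero hrS hv0 h1, mul_zero]
  obtain ⟨W, hW, haW, hWx⟩ := hφ.exists_ultrafilter hSE h0S ha hr T (fun u hu => hu.1) hTadd hu₀
    hu₀r hTprop
  have hWreg : (⟨W, hW⟩ : WeylGroupoid S E) ∈ region S E φ a r q :=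
    ⟨haW, fun x hx hxr ⟨k, hk⟩ => hWx x hx hxr ⟨_, hTmul k, hk⟩⟩
  obtain ⟨j, hj⟩ := Set.mem_iUnion.1 (hcov hWreg)
  obtain ⟨s, hsW, hsO⟩ := WeylGroupoid.exists_basicOpen_subset (hO j) hj
  have hWF := hW.isStarFilter
  obtain ⟨c, hc, hca, hcs⟩ := hWF.exists_common haW hsW
  obtain ⟨e, hec, he⟩ := hφ.memTrace_of_starDom hSE hWF haW hr hc hca
  have heO : WeylGroupoid.basicOpen S E (a * φ e) ⊆ O j := fun V hV =>
    hsO (V.2.isStarFilter.mem_of_starDom hV (hWF.subset hsW)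
      (mul_map_starDom_of_starDom hSE (hWF.subset hc) hec hca hcs))
  -- Interpolation `d' ≺ d ≺ e' ≺ e` in the trace of `W`: separation consumes `d ≺ e' ≺ e`, and `d'`
  -- detects that `d` is the identity near `W`.
  obtain ⟨e', he', hee, -⟩ := hφ.memTrace_directed hSE hWF haW hr he he
  obtain ⟨d, hd, hde, -⟩ := hφ.memTrace_directed hSE hWF haW hr he' he'
  obtain ⟨d', hd', hdd, -⟩ := hφ.memTrace_directed hSE hWF haW hr hd hd
  have hdT : d ∈ T := by
    refine ⟨hφ.nonneg d hd.sq, {j}, fun V hV hVn => ?_⟩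
    have hnot : a * φ e ∉ V.1 := fun h => hVn (by simpa using heO h)
    obtain ⟨v, hv, hvd⟩ := hφ.exists_memTrace_mul_eq_zero hSE h0S V.2 hV.1 hr hd.sq he'.sq he.sq
      hde hee he.mul_eq hnot
    exact ⟨v, hv, 0, by rw [hvd, zero_smul]⟩
  have hu : d + (r - q) ∈ T := hTadd _ hdT _ hu₀
  have h1 := hφ.posPart_mul_eq_of_le hrS hu₀r (le_add_of_nonneg_left (hφ.nonneg d hd.sq))
  have hxr := hφ.bump_mul_eq hrS hrS h1
  have hx : MemTrace S W φ a r (bump r (d + (r - q))) :=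
    ⟨hWx _ (hφ.bump_mem hrS _) hxr ⟨2 • (d + (r - q)), by rw [two_nsmul]; exact hTadd _ hu _ hu,
      hφ.posPart_mul_bump hrS hu.1 h1⟩, hφ.bump_mem hrS _, hxr⟩
  obtain ⟨w, hw, hwd, hwx⟩ := hφ.memTrace_directed hSE hWF haW hr hd' hx
  have hd0 := hφ.nonneg d' hd'.sq
  refine memTrace_ne_zero hSE h0S hW hw ?_
  have h2 : d' * (r - (d + (r - q))) ≤ 0 := by
    rw [mul_sub, mul_add, hdd, hd'.mul_eq, sub_add_cancel_left, neg_nonpos]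
    exact hB.mul_nonneg _ _ hd0 hrq
  rw [← hwx, ← hwd, mul_assoc, hφ.mul_bump_eq_zero hrS hd0 h2, mul_zero]

theorem locallyCompactSpace (h0S : (0 : A) ∈ S) : LocallyCompactSpace (WeylGroupoid S E) := by
  refine ⟨fun U n hn => ?_⟩
  obtain ⟨O, hOn, hO, hUO⟩ := mem_nhds_iff.1 hn
  obtain ⟨a, haU, haO⟩ := WeylGroupoid.exists_basicOpen_subset hO hUO
  have hUF := U.2.isStarFilter
  obtain ⟨b, hbU, hba⟩ := hUF.exists_starDom haU
  have haS := hUF.subset haU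
  have hbS := hUF.subset hbU
  obtain ⟨r, hr⟩ := hφ.exists_eq a haS
  obtain ⟨q, hq⟩ := hφ.exists_eq b hbS
  refine ⟨region S E φ a r q, ?_, fun V hV => hOn (haO hV.1),
    hφ.isCompact_region hSE h0S haS hbS hr hq hba⟩
  exact Filter.mem_of_superset ((WeylGroupoid.isOpen_basicOpen hbS).mem_nhds hbU)
    (hφ.basicOpen_subset_region hSE haS hr hq hba)

end IsDiagonal

end Compactness

/-! ### The diagonal structure on `L` and the conclusion. -/

section Main

variable {A : Type*} [NonUnitalRing A] [StarRing A]

theorem exists_isDiagonal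
    (hArch : IsArchimedeanStarRing A) (hInf : IsInfinitesimalFree A) (S : Set A)
    (hS : S ⊆ unitBall A) (L : NonUnitalSubring A) (hL : IsCommStarSubring L)
    (hHer : IsHereditary S (L : Set A)) (hLat : IsLatticeOn (L : Set A))
    (hCond : positives (L : Set A) = fractions (sumSquares (L : Set A)) ∨
      (IsUnital A ∧ PositiveProducts A)) :
    ∃ (_ : NonUnitalCommRing L) (_ : Lattice L) (_ : IsOrderedAddMonoid L) (φ : L →ₙ+* A),
      IsDiagonal S φ := by
  choose! sup hsupL hsup1 hsup2 hsup3 using hLat.exists_sup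
  choose! inf hinfL hinf1 hinf2 hinf3 using hLat.exists_inf
  have hrefl : Pos (0 : A) := pos_of_mem_sumCone (zero_mem _)
  let i1 : NonUnitalCommRing L :=
    { (inferInstance : NonUnitalRing L) with
      mul_comm := fun a b => Subtype.ext (hL.mul_comm a a.2 b b.2) }
  let i2 : Lattice L :=
    { le := fun a b => StarLE (a : A) b
      le_refl := fun a => starLE_iff.2 (by rwa [sub_self])
      le_trans := fun a b c hab hbc => by
        have := (starLE_iff.1 hab).add (starLE_iff.1 hbc)
        rw [add_comm, sub_add_sub_cancel] at this
        exact starLE_iff.2 this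
      le_antisymm := fun a b hab hba => by
        refine Subtype.ext (sub_eq_zero.1 (hInf _ hab ?_))
        rwa [neg_sub]
      sup := fun a b => ⟨sup a b, hsupL a a.2 b b.2⟩
      inf := fun a b => ⟨inf a b, hinfL a a.2 b b.2⟩
      le_sup_left := fun a b => hsup1 a a.2 b b.2
      le_sup_right := fun a b => hsup2 a a.2 b b.2
      sup_le := fun a b c h1 h2 => hsup3 a a.2 b b.2 c c.2 h1 h2
      inf_le_left := fun a b => hinf1 a a.2 b b.2
      inf_le_right := fun a b => hinf2 a a.2 b b.2
      le_inf := fun a b c h1 h2 => hinf3 b b.2 c c.2 a a.2 h1 h2 }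
  have hle : ∀ {a b : L}, a ≤ b ↔ Pos ((b : A) - a) := starLE_iff
  have hnn : ∀ {a : L}, 0 ≤ a ↔ Pos (a : A) := fun {a} => by
    rw [hle]; simp
  let i3 : IsOrderedAddMonoid L :=
    { add_le_add_left := fun a b h c => by
        rw [hle] at h ⊢
        simpa using h }
  have hstar : ∀ a : L, star (a : A) = a := by
    intro a
    -- The lattice structure writes every element of `L` as a difference of positive, hence
    -- self-adjoint, elements.
    have h1 : Pos ((a⁺ : L) : A) := hnn.1 (posPart_nonneg a)
    have h2 : Pos ((a⁻ : L) : A) := hnn.1 (negPart_nonneg a)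
    have h3 : (a : A) = ((a⁺ : L) : A) - ((a⁻ : L) : A) :=
      congrArg Subtype.val (posPart_sub_negPart a).symm
    rw [h3, star_sub, h1.star_eq hInf, h2.star_eq hInf]
  have hmul : ∀ {c x : L} {M : ℤ}, AlmostLE (c : A) M → 0 ≤ x → Pos (M • (x : A) - c * x) :=
    fun {c x M} h hx =>
      mul_pos_of_almostLE hArch hInf hL hCond h c.2 (hstar c) x.2 (hnn.1 hx)
  have hsq : ∀ p : A, p ∈ starSquares S → AlmostLE p 1 := by
    rintro _ ⟨s, hs, rfl⟩
    have h1 : starNorm s ≤ 1 := hS hs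
    have h2 : upperNorm (s * star s) ⊔ upperNorm (star s * s) ≤ 1 := by
      by_contra! h
      exact h1.not_gt (ENNReal.one_lt_rpow h (by norm_num))
    have h3 : upperNorm (star s * s) ≤ (1 : ℕ) := by simpa using le_sup_right.trans h2
    simpa using almostLE_of_upperNorm_le h3
  refine ⟨i1, i2, i3, NonUnitalSubringClass.subtype L, ⟨?_, ?_⟩, Subtype.val_injective, ?_, ?_, ?_, ?_, hstar⟩
  · intro a b ha hb
    -- With bound `0` for `-a`, the inequality `hmul` becomes positivity of `a * b`.
    have h1 : AlmostLE ((-a : L) : A) 0 := almostLE_of_upperNorm_le (M := 0)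
      (by simpa using le_of_eq (hnn.1 ha))
    have h2 := hmul h1 hb
    rw [hnn]
    simpa using h2
  · intro c hc
    obtain ⟨N, hN⟩ := exists_almostLE hArch (hnn.1 hc)
    refine ⟨N, fun x hx => hle.2 ?_⟩
    simpa using hmul hN hx
  · intro s hs
    exact ⟨⟨_, hHer.starSquares_subset ⟨s, hs, rfl⟩⟩, rfl⟩
  · rintro p ⟨s, -, hs⟩
    refine hnn.2 (pos_of_mem_sumCone ?_)
    change (p : A) = _ at hs
    rw [hs]
    simpa using mul_star_self_mem_sumCone (star s)
  · intro p hp x hx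
    refine hle.2 ?_
    simpa using hmul (hsq _ hp) hx
  · intro a p ha hap hp
    exact hHer.mem_of_le _ (mem_positives_iff.2 ⟨a.2, hnn.1 ha⟩) _ hp hap

end Main

end WeylStar
theorem corollary3p31 {A : Type*} [NonUnitalRing A] [StarRing A]
    (hArch : WeylStar.IsArchimedeanStarRing A)
    (hInf : WeylStar.IsInfinitesimalFree A)
    (hProper : WeylStar.IsProperStarRing A)
    (S E : Set A)
    (hSE : WeylStar.IsWeylStarSemigroup S E)
    (hS : S ⊆ WeylStar.unitBall A)
    (L : NonUnitalSubring A)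
    (hL : WeylStar.IsCommStarSubring L)
    (hHer : WeylStar.IsHereditary S (L : Set A))
    (hLat : WeylStar.IsLatticeOn (L : Set A))
    (hCond : WeylStar.positives (L : Set A) =
        WeylStar.fractions (WeylStar.sumSquares (L : Set A)) ∨
      (WeylStar.IsUnital A ∧ WeylStar.PositiveProducts A)) :
    LocallyCompactSpace (WeylStar.WeylGroupoid S E) := by
  -- Heredity puts zero into `S` only when some `*`-square exists; for empty `S` there are no
  -- filters.
  rcases S.eq_empty_or_nonempty with rfl | ⟨s, hs⟩
  · refine ⟨fun U => ?_⟩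
    obtain ⟨a, ha⟩ := U.2.isStarFilter.nonempty
    exact (U.2.isStarFilter.subset ha).elim
  · obtain ⟨_, _, _, φ, hφ⟩ :=
      WeylStar.exists_isDiagonal hArch hInf S hS L hL hHer hLat hCond
    exact hφ.locallyCompactSpace hSE (hφ.zero_mem hs)
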